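/- All sets are finite. A coherent configuration $\mathcal X=(\Omega,S)$ is a partition $S$ of $\Omega\times\Omega$ such that the diagonal $1_\Omega$ is a union of elements of $S$, the transpose $s^*$ of every $s\in S$ belongs to $S$, and for all $r,s,t\in S$ the number $c_{rs}^t=|\{\gamma\in\Omega : (\alpha,\gamma)\in r,\ (\gamma,\beta)\in s\}|$ does not depend on the choice of $(\alpha,\beta)\in t$. The elements of $S$ are the basis relations, their unions are the relations of $\mathcal X$. A coherent configuration is smaller than or equal to another one on the same set if all its relations are relations of the other. The coherent configuration $\operatorname{inv}(G)$ of a permutation group $G\le\operatorname{Sym}(\Omega)$ has the orbits of $G$ on $\Omega\times\Omega$ as basis relations. An algebraic isomorphism from $\mathcal X=(\Omega,S)$ to $\mathcal X'=(\Omega',S')$ is a bijection $\varphi:S\to S'$ with $c_{\varphi(r)\varphi(s)}^{\varphi(t)}=c_{rs}^t$ for all $r,s,t\in S$; it is extended to unions of basis relations in the obvious way. It is induced by an isomorphism if there is a bijection $f:\Omega\to\Omega'$ with $s^f=\varphi(s)$ for all $s\in S$. For $m\ge 1$, the $m$-extension of $\mathcal X$ is the smallest coherent configuration on $\Omega^m$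 among whose relations are all $s_1\otimes\cdots\otimes s_m=\{(\alpha,\beta)\in\Omega^m\times\Omega^m : (\alpha_i,\beta_i)\in s_i \text{ for all } i\}$ with $s_1,\dots,s_m\in S$, and the relation $1_{\operatorname{Diag}(\Omega^m)}=\{(\delta,\delta):\delta=(\alpha,\dots,\alpha),\ \alpha\in\Omega\}$. An algebraic isomorphism $\varphi$ from $\mathcal X$ to $\mathcal X'$ is $m$-dimensional if there is an algebraic isomorphism $\psi$ from the $m$-extension of $\mathcal X$ to the $m$-extension of $\mathcal X'$ such that $\psi(s_1\otimes\cdots\otimes s_m)=\varphi(s_1)\otimes\cdots\otimes\varphi(s_m)$ for all $s_1,\dots,s_m\in S$ and $\psi(1_{\operatorname{Diag}(\Omega^m)})=1_{\operatorname{Diag}(\Omega'^m)}$. The separability number $s(\mathcal X)$ is the smallest positive integer $m$ such that every $m$-dimensional algebraic isomorphism from $\mathcal X$ to a coherent configuration is induced by an isomorphism. Theorem. Let $q$ be an odd prime power, let $G\le\operatorname{AGL}(2,q)$ be the group of all permutations $x\mapsto Ax+b$ of $\mathbb F_q^2$, where $b\in\mathbb F_q^2$ and $A$ is a monomial $2\times2$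 matrix over $\mathbb F_q$ (exactly one nonzero entry in every row and every column) with $\det A=\pm1$, and let $\mathcal X=\operatorname{inv}(G)$ be the Passman scheme of degree $q^2$. Then $s(\mathcal X)\le 3$. -/

import Mathlib

universe u v

/-- A coherent configuration on the point set `Ω`. The partition `S` of `Ω × Ω` into basis
relations is given by the equivalence relation `rel` on `Ω × Ω` whose classes are the elements
of `S`. -/
structure CoherentConfiguration (Ω : Type u) where
  /-- Two pairs are equivalent when they lie in the same basis relation. -/
  rel : Setoid (Ω × Ω)
  /-- The diagonal is a union of basis relations. -/
  diag : ∀ {a b c : Ω}, rel (a, a) (b, c) → b = c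
  /-- The transpose of a basis relation is a basis relation. -/
  transpose : ∀ {a b c d : Ω}, rel (a, b) (c, d) → rel (b, a) (d, c)
  /-- For the basis relations `r ∋ x` and `s ∋ y`, the number of `γ` with `(α, γ) ∈ r` and
  `(γ, β) ∈ s` depends only on the basis relation that contains `(α, β)`. -/
  coherent : ∀ x y p p' : Ω × Ω, rel p p' →
    {c : Ω | rel (p.1, c) x ∧ rel (c, p.2) y}.ncard =
      {c : Ω | rel (p'.1, c) x ∧ rel (c, p'.2) y}.ncard

namespace CoherentConfiguration

variable {Ω : Type u} {Ω' : Type v}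

/-- The set `S` of basis relations. -/
abbrev BasisRel (X : CoherentConfiguration Ω) : Type u := Quotient X.rel

/-- The basis relation `r(α, β)` containing `(α, β)`. -/
def r (X : CoherentConfiguration Ω) (a b : Ω) : X.BasisRel := Quotient.mk X.rel (a, b)

/-- A basis relation as a set of pairs. -/
def graph (X : CoherentConfiguration Ω) (s : X.BasisRel) : Set (Ω × Ω) :=
  {p | X.r p.1 p.2 = s}

/-- The relations of `X`: the unions of basis relations. -/
def IsRelation (X : CoherentConfiguration Ω) (R : Set (Ω × Ω)) : Prop :=
  ∃ T : Set X.BasisRel, R = ⋃ t ∈ T, X.graph t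

/-- `X ≤ Y` if every relation of `X` is a relation of `Y`. -/
instance : LE (CoherentConfiguration Ω) where
  le X Y := ∀ R, X.IsRelation R → Y.IsRelation R

theorem r_eq_iff (X : CoherentConfiguration Ω) (a b c d : Ω) :
    X.r a b = X.r c d ↔ X.rel (a, b) (c, d) :=
  Quotient.eq (r := X.rel)

theorem isRelation_iff (X : CoherentConfiguration Ω) (R : Set (Ω × Ω)) :
    X.IsRelation R ↔ ∀ p q, X.rel p q → p ∈ R → q ∈ R := by
  constructor
  · rintro ⟨T, rfl⟩ p q h hp
    simp only [Set.mem_iUnion, graph, Set.mem_ofPred_eq, exists_prop] at hp ⊢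
    obtain ⟨t, ht, rfl⟩ := hp
    exact ⟨_, ht, (X.r_eq_iff _ _ _ _).2 (X.rel.symm' h)⟩
  · intro h
    refine ⟨{t | ∃ p ∈ R, X.r p.1 p.2 = t}, ?_⟩
    ext q
    simp only [Set.mem_iUnion, graph, Set.mem_ofPred_eq, exists_prop]
    constructor
    · intro hq
      exact ⟨_, ⟨q, hq, rfl⟩, rfl⟩
    · rintro ⟨t, ⟨p, hp, rfl⟩, e⟩
      exact h p q (X.rel.symm' ((X.r_eq_iff _ _ _ _).1 e)) hp

/-- The intersection number `c_{rs}^t = |α r ∩ β s*|`, where `(α, β) ∈ t`. -/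
noncomputable def intersectionNumber (X : CoherentConfiguration Ω) (r s t : X.BasisRel) : ℕ :=
  Quotient.lift (fun p : Ω × Ω => {c : Ω | X.r p.1 c = r ∧ X.r c p.2 = s}.ncard)
    (by
      intro p p' h
      induction r using Quotient.inductionOn with | _ x
      induction s using Quotient.inductionOn with | _ y
      have := X.coherent x y p p' h
      have key : ∀ (a b : Ω) (z : Ω × Ω), X.r a b = Quotient.mk X.rel z ↔ X.rel (a, b) z :=
        fun a b z => X.r_eq_iff a b z.1 z.2
      simp only [key]
      exact this) t

/-- An algebraic isomorphism: a bijection between the sets of basis relations that preserves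
the intersection numbers. -/
structure AlgIso (X : CoherentConfiguration Ω) (X' : CoherentConfiguration Ω') where
  toEquiv : X.BasisRel ≃ X'.BasisRel
  map_intersectionNumber : ∀ r s t : X.BasisRel,
    X'.intersectionNumber (toEquiv r) (toEquiv s) (toEquiv t) = X.intersectionNumber r s t

/-- The map on relations induced by an algebraic isomorphism: the union of basis relations
`r ∪ s ∪ ⋯` is sent to `φ(r) ∪ φ(s) ∪ ⋯`. -/
def AlgIso.mapRel {X : CoherentConfiguration Ω} {X' : CoherentConfiguration Ω'}
    (φ : AlgIso X X') (R : Set (Ω × Ω)) : Set (Ω' × Ω') :=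
  ⋃ t ∈ {t : X.BasisRel | X.graph t ⊆ R}, X'.graph (φ.toEquiv t)

/-- The algebraic isomorphism `φ` is induced by the bijection `f`: every basis relation `s` is
mapped by `f` onto the basis relation `φ(s)`. Since `φ` is a bijection of the sets of basis
relations, such an `f` is an isomorphism of coherent configurations. -/
def AlgIso.IsInducedBy {X : CoherentConfiguration Ω} {X' : CoherentConfiguration Ω'}
    (φ : AlgIso X X') (f : Ω ≃ Ω') : Prop :=
  ∀ s : X.BasisRel, Prod.map f f '' X.graph s = X'.graph (φ.toEquiv s)

theorem rel_le_closure {T : Set (Set (Ω × Ω))} {Y : CoherentConfiguration Ω}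
    (hY : ∀ R ∈ T, Y.IsRelation R) :
    Y.rel ≤ sSup {e | ∃ Y : CoherentConfiguration Ω, (∀ R ∈ T, Y.IsRelation R) ∧ Y.rel = e} :=
  le_sSup ⟨Y, hY, rfl⟩

theorem closure_induction {T : Set (Set (Ω × Ω))} (e : Setoid (Ω × Ω))
    (h : ∀ Y : CoherentConfiguration Ω, (∀ R ∈ T, Y.IsRelation R) → Y.rel ≤ e) :
    sSup {e | ∃ Y : CoherentConfiguration Ω, (∀ R ∈ T, Y.IsRelation R) ∧ Y.rel = e} ≤ e := by
  apply sSup_le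
  rintro _ ⟨Y, hY, rfl⟩
  exact h Y hY

theorem coherent_of_le [Finite Ω] (Y : CoherentConfiguration Ω) (E : Setoid (Ω × Ω))
    (hE : Y.rel ≤ E) (x y p p' : Ω × Ω) (h : Y.rel p p') :
    {c : Ω | E (p.1, c) x ∧ E (c, p.2) y}.ncard =
      {c : Ω | E (p'.1, c) x ∧ E (c, p'.2) y}.ncard := by
  classical
  have := Fintype.ofFinite Ω
  have : Finite Y.BasisRel := Quotient.finite Y.rel
  have := Fintype.ofFinite Y.BasisRel
  have key : ∀ p : Ω × Ω, {c : Ω | E (p.1, c) x ∧ E (c, p.2) y}.ncard =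
      ∑ rs : Y.BasisRel × Y.BasisRel,
        if (∃ a b, Y.r a b = rs.1 ∧ E (a, b) x) ∧ (∃ a b, Y.r a b = rs.2 ∧ E (a, b) y) then
          Y.intersectionNumber rs.1 rs.2 (Y.r p.1 p.2) else 0 := by
    intro p
    rw [Set.ncard_eq_toFinset_card']
    rw [Finset.card_eq_sum_card_fiberwise (t := Finset.univ)
      (f := fun c => (Y.r p.1 c, Y.r c p.2)) (fun _ _ => Finset.mem_coe.2 (Finset.mem_univ _))]
    refine Finset.sum_congr rfl ?_
    rintro ⟨r, s⟩ -
    split_ifs with hrs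
    · obtain ⟨⟨a, b, hab, habx⟩, ⟨a', b', hab', haby⟩⟩ := hrs
      change _ = {c : Ω | Y.r p.1 c = r ∧ Y.r c p.2 = s}.ncard
      rw [Set.ncard_eq_toFinset_card']
      congr 1
      ext c
      simp only [Finset.mem_filter, Set.mem_toFinset, Set.mem_ofPred_eq, Prod.mk.injEq]
      constructor
      · exact fun h => h.2
      · rintro ⟨h1, h2⟩
        refine ⟨⟨?_, ?_⟩, h1, h2⟩
        · exact E.trans' (hE ((Y.r_eq_iff _ _ _ _).1 (h1.trans hab.symm))) habx
        · exact E.trans' (hE ((Y.r_eq_iff _ _ _ _).1 (h2.trans hab'.symm))) haby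
    · rw [Finset.card_eq_zero, Finset.filter_eq_empty_iff]
      intro c hc he
      simp only [Set.mem_toFinset, Set.mem_ofPred_eq] at hc
      simp only [Prod.mk.injEq] at he
      exact hrs ⟨⟨_, _, he.1, hc.1⟩, ⟨_, _, he.2, hc.2⟩⟩
  rw [key p, key p', (Y.r_eq_iff _ _ _ _).2 (show Y.rel (p.1, p.2) (p'.1, p'.2) from h)]

/-- The coherent closure `WL(T)`: the smallest coherent configuration on `Ω` of which all
elements of `T` are relations. -/
def coherentClosure [Finite Ω] (T : Set (Set (Ω × Ω))) : CoherentConfiguration Ω where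
  rel := sSup {e | ∃ Y : CoherentConfiguration Ω, (∀ R ∈ T, Y.IsRelation R) ∧ Y.rel = e}
  diag := by
    intro a b c h
    have := closure_induction (T := T) (Setoid.ker fun p : Ω × Ω => p.1 = p.2) (by
      rintro Y - ⟨a, b⟩ ⟨c, d⟩ h
      refine propext ⟨?_, ?_⟩
      · intro e
        obtain rfl : a = b := e
        exact Y.diag h
      · intro e
        obtain rfl : c = d := e
        exact Y.diag (Y.rel.symm' h)) h
    exact (show (a = a) = (b = c) from this).mp rfl
  transpose := by
    intro a b c d h
    exact closure_induction (T := T) (Setoid.comap Prod.swap (sSup _))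
      (fun Y hY _ _ h => rel_le_closure hY (Y.transpose h)) h
  coherent := by
    intro x y p p' h
    exact closure_induction (T := T)
      (Setoid.ker fun p : Ω × Ω => {c : Ω | (sSup _ : Setoid (Ω × Ω)) (p.1, c) x ∧
        (sSup _ : Setoid (Ω × Ω)) (c, p.2) y}.ncard)
      (fun Y hY p p' h => coherent_of_le Y _ (rel_le_closure hY) x y p p' h) h

theorem coherentClosure_isLeast [Finite Ω] (T : Set (Set (Ω × Ω))) :
    IsLeast {Y : CoherentConfiguration Ω | ∀ R ∈ T, Y.IsRelation R} (coherentClosure T) := by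
  constructor
  · intro R hR
    rw [isRelation_iff]
    intro p q h
    have := closure_induction (T := T) (Setoid.ker fun p => p ∈ R) (by
      intro Y hY p q h
      exact propext ⟨(Y.isRelation_iff R).1 (hY R hR) p q h,
        (Y.isRelation_iff R).1 (hY R hR) q p (Y.rel.symm' h)⟩) h
    exact (show (p ∈ R) = (q ∈ R) from this).mp
  · intro Y hY R hR
    rw [isRelation_iff] at hR ⊢
    exact fun p q h => hR p q (rel_le_closure hY h)

/-- The basis relation `s₁ ⊗ ⋯ ⊗ sₘ` of the Cartesian `m`-power of `X`. -/
def tensor (X : CoherentConfiguration Ω) {m : ℕ} (s : Fin m → X.BasisRel) :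
    Set ((Fin m → Ω) × (Fin m → Ω)) :=
  {p | ∀ i, (p.1 i, p.2 i) ∈ X.graph (s i)}

/-- The relation `1_Δ` on `Ω^m`, where `Δ = Diag(Ω^m)`. -/
def diagRel (Ω : Type u) (m : ℕ) : Set ((Fin m → Ω) × (Fin m → Ω)) :=
  {p | p.1 = p.2 ∧ ∃ a : Ω, ∀ i, p.1 i = a}

/-- The `m`-extension of `X`: the smallest coherent configuration on `Ω^m` that contains the
Cartesian `m`-power of `X` and for which `Diag(Ω^m)` is a union of fibers. -/
def mExtension [Finite Ω] (X : CoherentConfiguration Ω) (m : ℕ) :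
    CoherentConfiguration (Fin m → Ω) :=
  coherentClosure (Set.range (X.tensor (m := m)) ∪ {diagRel Ω m})

/-- The algebraic isomorphism `φ` is `m`-dimensional: it extends to an algebraic isomorphism `ψ`
of the `m`-extensions that takes `Diag(Ω^m)` to `Diag(Ω'^m)`. That `ψ` extends `φ` means that on
the Cartesian `m`-power of `X` it is `s₁ ⊗ ⋯ ⊗ sₘ ↦ φ(s₁) ⊗ ⋯ ⊗ φ(sₘ)`. -/
def AlgIso.IsMDimensional [Finite Ω] [Finite Ω'] {X : CoherentConfiguration Ω}
    {X' : CoherentConfiguration Ω'} (φ : AlgIso X X') (m : ℕ) : Prop :=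
  ∃ ψ : AlgIso (X.mExtension m) (X'.mExtension m),
    (∀ s : Fin m → X.BasisRel, ψ.mapRel (X.tensor s) = X'.tensor fun i => φ.toEquiv (s i)) ∧
      ψ.mapRel (diagRel Ω m) = diagRel Ω' m

/-- Every `m`-dimensional algebraic isomorphism from `X` to a coherent configuration is induced
by an isomorphism. -/
def IsMSeparable {Ω : Type u} [Finite Ω] (X : CoherentConfiguration Ω) (m : ℕ) : Prop :=
  ∀ (Ω' : Type u) [Finite Ω'] (X' : CoherentConfiguration Ω') (φ : AlgIso X X'),
    φ.IsMDimensional m → ∃ f : Ω ≃ Ω', φ.IsInducedBy f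

/-- The separability number `s(X)`: the smallest positive integer `m` for which every
`m`-dimensional algebraic isomorphism from `X` is induced by an isomorphism (`⊤` if there is
no such `m`). -/
noncomputable def separabilityNumber {Ω : Type u} [Finite Ω] (X : CoherentConfiguration Ω) : ℕ∞ :=
  ⨅ (m : ℕ) (_ : 1 ≤ m) (_ : X.IsMSeparable m), (m : ℕ∞)

/-- The coherent configuration `inv(G)` of a permutation group `G`: the basis relations are the
orbits of `G` on `Ω × Ω`. -/
def inv (G : Subgroup (Equiv.Perm Ω)) : CoherentConfiguration Ω where
  rel := MulAction.orbitRel G (Ω × Ω)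
  diag := by
    rintro a b c h
    obtain ⟨g, hg⟩ := MulAction.orbitRel_apply.1 h
    obtain ⟨h1, h2⟩ := Prod.mk.inj hg
    exact MulAction.injective g (h1.trans h2.symm)
  transpose := by
    rintro a b c d h
    obtain ⟨g, hg⟩ := MulAction.orbitRel_apply.1 h
    obtain ⟨h1, h2⟩ := Prod.mk.inj hg
    exact MulAction.orbitRel_apply.2 ⟨g, Prod.ext h2 h1⟩
  coherent := by
    rintro x y p p' h
    obtain ⟨g, rfl⟩ := MulAction.orbitRel_apply.1 h
    have key : ∀ a b : Ω, ∀ z : Ω × Ω, MulAction.orbitRel G (Ω × Ω) (g • a, g • b) z ↔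
        MulAction.orbitRel G (Ω × Ω) (a, b) z := by
      intro a b z
      rw [MulAction.orbitRel_apply, MulAction.orbitRel_apply]
      change g • (a, b) ∈ MulAction.orbit G z ↔ _
      rw [← MulAction.orbit_eq_iff, MulAction.orbit_smul, MulAction.orbit_eq_iff]
    rw [← Set.ncard_image_of_injective {c : Ω | MulAction.orbitRel G (Ω × Ω) (p'.1, c) x ∧
        MulAction.orbitRel G (Ω × Ω) (c, p'.2) y} (MulAction.injective g)]
    congr 1
    ext c
    obtain ⟨c, rfl⟩ := MulAction.surjective g c
    rw [(MulAction.injective g).mem_set_image]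
    exact and_congr (key _ _ _) (key _ _ _)

end CoherentConfiguration

/-- A matrix is monomial if every row and every column has exactly one nonzero entry. -/
def Matrix.IsMonomial {n F : Type*} [Zero F] (A : Matrix n n F) : Prop :=
  (∀ i, ∃! j, A i j ≠ 0) ∧ ∀ j, ∃! i, A i j ≠ 0

theorem Matrix.isMonomial_fin_two_iff {F : Type*} [Zero F] (A : Matrix (Fin 2) (Fin 2) F) :
    A.IsMonomial ↔ (A 0 0 ≠ 0 ∧ A 0 1 = 0 ∧ A 1 0 = 0 ∧ A 1 1 ≠ 0) ∨
      (A 0 0 = 0 ∧ A 0 1 ≠ 0 ∧ A 1 0 ≠ 0 ∧ A 1 1 = 0) := by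
  simp only [Matrix.IsMonomial, ExistsUnique, Fin.forall_fin_two, Fin.exists_fin_two]
  by_cases h1 : A 0 0 = 0 <;> by_cases h2 : A 0 1 = 0 <;> by_cases h3 : A 1 0 = 0 <;>
    by_cases h4 : A 1 1 = 0 <;> simp [h1, h2, h3, h4]

/-- The group of the permutations `x ↦ A x + b` of `F²`, where `A` is a monomial matrix of
determinant `±1`. -/
def passmanGroup (F : Type u) [Field F] : Subgroup (Equiv.Perm (Fin 2 → F)) where
  carrier := {g | ∃ (A : Matrix (Fin 2) (Fin 2) F) (b : Fin 2 → F),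
    A.IsMonomial ∧ (A.det = 1 ∨ A.det = -1) ∧ ∀ x, g x = A.mulVec x + b}
  one_mem' := by
    refine ⟨1, 0, ?_, by simp, by simp⟩
    rw [Matrix.isMonomial_fin_two_iff]
    simp
  mul_mem' := by
    rintro g h ⟨A, b, hA, hdA, hg⟩ ⟨B, c, hB, hdB, hh⟩
    refine ⟨A * B, A.mulVec c + b, ?_, ?_, ?_⟩
    · rw [Matrix.isMonomial_fin_two_iff] at hA hB ⊢
      simp only [Matrix.mul_apply, Fin.sum_univ_two]
      rcases hA with ⟨h1, h2, h3, h4⟩ | ⟨h1, h2, h3, h4⟩ <;>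
        rcases hB with ⟨k1, k2, k3, k4⟩ | ⟨k1, k2, k3, k4⟩ <;> simp [*]
    · rw [Matrix.det_mul]
      rcases hdA with h | h <;> rcases hdB with k | k <;> simp [h, k]
    · intro x
      rw [Equiv.Perm.mul_apply, hg, hh, Matrix.mulVec_add, Matrix.mulVec_mulVec, add_assoc]
  inv_mem' := by
    rintro g ⟨A, b, hA, hdA, hg⟩
    have hu : IsUnit A.det := by rcases hdA with h | h <;> simp [h]
    refine ⟨A⁻¹, -A⁻¹.mulVec b, ?_, ?_, ?_⟩
    · rw [Matrix.isMonomial_fin_two_iff] at hA ⊢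
      rw [Matrix.inv_def, Matrix.adjugate_fin_two]
      have hu' : Ring.inverse A.det ≠ 0 := by
        rw [Ring.inverse_eq_inv']
        exact inv_ne_zero hu.ne_zero
      rcases hA with ⟨h1, h2, h3, h4⟩ | ⟨h1, h2, h3, h4⟩ <;> simp [*] <;> exact hu.ne_zero
    · rw [Matrix.det_nonsing_inv, Ring.inverse_eq_inv']
      rcases hdA with h | h <;> simp [h]
    · intro x
      rw [Equiv.Perm.inv_eq_iff_eq, hg, ← sub_eq_add_neg, ← Matrix.mulVec_sub,
        Matrix.mulVec_mulVec, Matrix.mul_nonsing_inv _ hu, Matrix.one_mulVec, sub_add_cancel]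

/-- The Passman scheme of degree `q²`, where `q` is the order of the finite field `F` of odd
characteristic. -/
def passmanScheme (F : Type u) [Field F] : CoherentConfiguration (Fin 2 → F) :=
  CoherentConfiguration.inv (passmanGroup F)

/-! Fix a tuple `α` and suppose that, in the `m`-extension, its colours to the tuples differing from
it in one entry separate these tuples. An algebraic isomorphism `ψ` of the `m`-extensions sends the
colours at `α` to those at some `α'`, so it sends each `x` to a unique tuple over `α'`. The
triangles through `α` show that reading off the varying entry gives an isomorphism inducing `φ`
(`isMSeparable_of_update`).

For the Passman scheme take the points (0,0), (1,0), (0,1), the third entry varying. The function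
`((x₀ - y₀)(x₁ - y₁))²` of a pair is an invariant, since the matrices are monomial of determinant
`±1`. With (0,0) and (1,0) fixed, it determines `x₁²` (`passman_snd_sq`) and then, as `2 ≠ 0`, also
`x₀` (`passman_fst_eq`). The colour with (0,1) removes the remaining sign of `x₁` (`passman_eq`).
Where the equations degenerate on a coordinate axis, an auxiliary point on a common axis-parallel
line is used: the invariant vanishes on such lines. -/

namespace CoherentConfiguration

/-! ### Algebraic isomorphisms and triangles of basis relations -/

section AlgIso

variable {Ω : Type u} {Ω' : Type v}

theorem intersectionNumber_r (X : CoherentConfiguration Ω) (s t : X.BasisRel) (a b : Ω) :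
    X.intersectionNumber s t (X.r a b) = {c : Ω | X.r a c = s ∧ X.r c b = t}.ncard :=
  rfl

theorem intersectionNumber_r_ne_zero_iff [Finite Ω] (X : CoherentConfiguration Ω)
    (s t : X.BasisRel) (a b : Ω) :
    X.intersectionNumber s t (X.r a b) ≠ 0 ↔ ∃ c, X.r a c = s ∧ X.r c b = t := by
  rw [intersectionNumber_r, ne_eq, Set.ncard_eq_zero, ← ne_eq, ← Set.nonempty_iff_ne_empty]
  rfl

theorem exists_r_eq (X : CoherentConfiguration Ω) (s : X.BasisRel) : ∃ a b, X.r a b = s := by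
  induction s using Quotient.inductionOn with | _ p
  exact ⟨p.1, p.2, rfl⟩

theorem eq_of_r_self_eq (X : CoherentConfiguration Ω) {a b c : Ω} (h : X.r a a = X.r b c) :
    b = c :=
  X.diag ((X.r_eq_iff _ _ _ _).1 h)

/-- A triangle of basis relations over a pair can be completed over every other pair in the same
basis relation. -/
theorem exists_of_rel [Finite Ω] (X : CoherentConfiguration Ω) {p q : Ω × Ω} (h : X.rel p q)
    (c : Ω) : ∃ d, X.rel (p.1, c) (q.1, d) ∧ X.rel (c, p.2) (d, q.2) := by
  have h1 : X.r p.1 p.2 = X.r q.1 q.2 := (X.r_eq_iff _ _ _ _).2 h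
  have h2 := (X.intersectionNumber_r_ne_zero_iff (X.r p.1 c) (X.r c p.2) p.1 p.2).2 ⟨c, rfl, rfl⟩
  rw [h1, intersectionNumber_r_ne_zero_iff] at h2
  obtain ⟨d, hd, hd'⟩ := h2
  exact ⟨d, (X.r_eq_iff _ _ _ _).1 hd.symm, (X.r_eq_iff _ _ _ _).1 hd'.symm⟩

variable {X : CoherentConfiguration Ω} {X' : CoherentConfiguration Ω'} [Finite Ω] [Finite Ω']

/-- Algebraic isomorphisms transfer triangles of basis relations. -/
theorem AlgIso.exists_map_r (φ : AlgIso X X') {a b : Ω} {a' b' : Ω'}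
    (h : φ.toEquiv (X.r a b) = X'.r a' b') (c : Ω) :
    ∃ c', φ.toEquiv (X.r a c) = X'.r a' c' ∧ φ.toEquiv (X.r c b) = X'.r c' b' := by
  have h2 := (X.intersectionNumber_r_ne_zero_iff (X.r a c) (X.r c b) a b).2 ⟨c, rfl, rfl⟩
  rw [← φ.map_intersectionNumber, h, intersectionNumber_r_ne_zero_iff] at h2
  obtain ⟨d, hd, hd'⟩ := h2
  exact ⟨d, hd.symm, hd'.symm⟩

/-- The inverse of an algebraic isomorphism transfers triangles of basis relations. -/
theorem AlgIso.exists_comap_r (φ : AlgIso X X') {a b : Ω} {a' b' : Ω'}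
    (h : φ.toEquiv (X.r a b) = X'.r a' b') (c' : Ω') :
    ∃ c, φ.toEquiv (X.r a c) = X'.r a' c' ∧ φ.toEquiv (X.r c b) = X'.r c' b' := by
  have h2 := (X'.intersectionNumber_r_ne_zero_iff (X'.r a' c') (X'.r c' b') a' b').2 ⟨c', rfl, rfl⟩
  obtain ⟨s, hs⟩ := φ.toEquiv.surjective (X'.r a' c')
  obtain ⟨t, ht⟩ := φ.toEquiv.surjective (X'.r c' b')
  rw [← h, ← hs, ← ht, φ.map_intersectionNumber, intersectionNumber_r_ne_zero_iff] at h2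
  obtain ⟨c, rfl, rfl⟩ := h2
  exact ⟨c, hs, ht⟩

/-- Reflexivity is visible in triangles: pulling `a'` back along the pair gives a point that can
only be `a`, so `(a', a')` and `(a', b')` have the same colour. -/
theorem AlgIso.eq_of_map_r_self (φ : AlgIso X X') {a : Ω} {a' b' : Ω'}
    (h : φ.toEquiv (X.r a a) = X'.r a' b') : a' = b' := by
  obtain ⟨c, hc, hc'⟩ := φ.exists_comap_r h a'
  have hca : c = a := X.eq_of_r_self_eq (φ.toEquiv.injective (h.trans hc'.symm))
  subst hca
  exact X'.eq_of_r_self_eq (hc.symm.trans h)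

theorem AlgIso.eq_of_map_r_eq_self (φ : AlgIso X X') {a b : Ω} {a' : Ω'}
    (h : φ.toEquiv (X.r a b) = X'.r a' a') : a = b := by
  obtain ⟨c', hc, hc'⟩ := φ.exists_map_r h a
  have : c' = a' := X'.eq_of_r_self_eq (h.symm.trans hc')
  subst this
  exact X.eq_of_r_self_eq (φ.toEquiv.injective (hc.trans h.symm))

end AlgIso

/-! ### The `m`-extension and a criterion for `m`-separability -/

section Extension

variable {Ω : Type u} [Finite Ω]

theorem rel_apply_of_mExtension_rel (X : CoherentConfiguration Ω) {m : ℕ}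
    {p q : (Fin m → Ω) × (Fin m → Ω)} (h : (X.mExtension m).rel p q) (i : Fin m) :
    X.rel (p.1 i, p.2 i) (q.1 i, q.2 i) := by
  have hR := (coherentClosure_isLeast (Set.range (X.tensor (m := m)) ∪ {diagRel Ω m})).1
    (X.tensor fun i => X.r (p.1 i) (p.2 i)) (Or.inl ⟨_, rfl⟩)
  have := (isRelation_iff _ _).1 hR p q h (fun i => rfl)
  exact (X.r_eq_iff _ _ _ _).1 (this i).symm

theorem exists_forall_eq_of_mExtension_rel (X : CoherentConfiguration Ω) {m : ℕ} {a : Ω}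
    {q : (Fin m → Ω) × (Fin m → Ω)} (h : (X.mExtension m).rel (fun _ => a, fun _ => a) q) :
    ∃ b, ∀ i, q.1 i = b := by
  have hR := (coherentClosure_isLeast (Set.range (X.tensor (m := m)) ∪ {diagRel Ω m})).1
    (diagRel Ω m) (Or.inr rfl)
  exact ((isRelation_iff _ _).1 hR _ q h ⟨rfl, a, fun _ => rfl⟩).2

/-- The basis relations between the entries of a tuple are determined by its fiber in the
`m`-extension. -/
theorem rel_entries_of_mExtension_rel (X : CoherentConfiguration Ω) {m : ℕ} {α β : Fin m → Ω}
    (h : (X.mExtension m).rel (α, α) (β, β)) (i j : Fin m) :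
    X.rel (α i, α j) (β i, β j) := by
  -- The constant tuple with value `α i` serves as an intermediate point: its counterpart `δ` is
  -- again constant, and comparing entry `i` shows that its value is `β i`.
  obtain ⟨δ, hδ, hδ'⟩ := (X.mExtension m).exists_of_rel h fun _ => α i
  obtain ⟨ε, hε, hε'⟩ := (X.mExtension m).exists_of_rel hδ' fun _ => α i
  have hεδ : δ = ε := (X.mExtension m).diag hε
  subst hεδ
  obtain ⟨b, hb⟩ := X.exists_forall_eq_of_mExtension_rel hε
  have hi := X.diag (X.rel_apply_of_mExtension_rel hδ i)
  have hj := X.rel_apply_of_mExtension_rel hδ' j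
  dsimp only at hi hj hb
  rwa [hb j, ← hb i, ← hi] at hj

theorem AlgIso.map_r_apply_of_tensor {Ω' : Type v} [Finite Ω'] {X : CoherentConfiguration Ω}
    {X' : CoherentConfiguration Ω'} {m : ℕ} {φ : AlgIso X X'}
    {ψ : AlgIso (X.mExtension m) (X'.mExtension m)}
    (hψ : ∀ s : Fin m → X.BasisRel, ψ.mapRel (X.tensor s) = X'.tensor fun i => φ.toEquiv (s i))
    {α β : Fin m → Ω} {α' β' : Fin m → Ω'}
    (h : ψ.toEquiv ((X.mExtension m).r α β) = (X'.mExtension m).r α' β') (i : Fin m) :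
    φ.toEquiv (X.r (α i) (β i)) = X'.r (α' i) (β' i) := by
  have hmem : (α', β') ∈ ψ.mapRel (X.tensor fun i => X.r (α i) (β i)) := by
    simp only [AlgIso.mapRel, Set.mem_iUnion]
    refine ⟨(X.mExtension m).r α β, ?_, h.symm⟩
    intro p hp i
    have hp' : (X.mExtension m).rel p (α, β) := ((X.mExtension m).r_eq_iff _ _ _ _).1 hp
    exact (X.r_eq_iff _ _ _ _).2 (X.rel_apply_of_mExtension_rel hp' i)
  rw [hψ] at hmem
  exact (hmem i).symm

/-- If the tuples that differ from a fixed tuple `α` in the `i`-th entry only are separated by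
their basis relations with `α` in the `m`-extension, then `X` is `m`-separable. -/
theorem isMSeparable_of_update (X : CoherentConfiguration Ω) {m : ℕ} (α : Fin m → Ω) (i : Fin m)
    (hα : ∀ x y, (X.mExtension m).rel (α, Function.update α i x) (α, Function.update α i y) →
      x = y) : X.IsMSeparable m := by
  rintro Ω' _ X' φ ⟨ψ, hψ, -⟩
  have hψ' := fun {β γ : Fin m → Ω} {β' γ' : Fin m → Ω'} =>
    AlgIso.map_r_apply_of_tensor hψ (α := β) (β := γ) (α' := β') (β' := γ')
  obtain ⟨α', α'', hα'⟩ := exists_r_eq _ (ψ.toEquiv ((X.mExtension m).r α α))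
  have e := ψ.eq_of_map_r_self hα'.symm
  subst e
  -- Off `i` the colour of `γ` with `α` is that of a diagonal pair, so `γ` differs from `α` in entry
  -- `i` only, and `hα` applies.
  have hupd : ∀ γ x, (X.mExtension m).r α γ = (X.mExtension m).r α (Function.update α i x) →
      γ = Function.update α i x := by
    intro γ x h
    have h' := ((X.mExtension m).r_eq_iff _ _ _ _).1 h
    have hγ : γ = Function.update α i (γ i) := by
      refine Function.eq_update_iff.2 ⟨rfl, fun j hj => ?_⟩
      have := X.rel_apply_of_mExtension_rel ((X.mExtension m).rel.symm' h') j
      simp only [Function.update_of_ne hj] at this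
      exact (X.diag this).symm
    rw [hγ] at h' ⊢
    rw [hα _ _ h']
  have hex := fun x => ψ.exists_map_r hα'.symm (Function.update α i x)
  choose g hg _ using hex
  have huniq : ∀ x γ', ψ.toEquiv ((X.mExtension m).r α (Function.update α i x)) =
      (X'.mExtension m).r α' γ' → γ' = g x := by
    intro x γ' h
    obtain ⟨γ, hγ, hγ'⟩ := ψ.exists_comap_r (hg x) γ'
    have := hupd γ x (ψ.toEquiv.injective (hγ.trans h.symm))
    subst this
    exact ψ.eq_of_map_r_self hγ'
  -- Map the triangle on `α`, `update α i y`, `update α i x`; uniqueness forces its third vertex to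
  -- be `g x`, and entry `i` of the remaining side is the claim.
  have hpair : ∀ x y, φ.toEquiv (X.r x y) = X'.r (g x i) (g y i) := by
    intro x y
    obtain ⟨γ', h, h'⟩ := ψ.exists_map_r (hg y) (Function.update α i x)
    obtain rfl := huniq x γ' h
    simpa using hψ' h' i
  have hinj : Function.Injective fun x => g x i := by
    intro x y h
    have := hpair x y
    rw [show g y i = g x i from h.symm] at this
    exact φ.eq_of_map_r_eq_self this
  have hsurj : Function.Surjective fun x => g x i := by
    intro x'
    obtain ⟨γ, h, -⟩ := ψ.exists_comap_r hα'.symm (Function.update α' i x')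
    have hγ : γ = Function.update α i (γ i) := by
      refine Function.eq_update_iff.2 ⟨rfl, fun j hj => ?_⟩
      have := hψ' h j
      rw [Function.update_of_ne hj] at this
      exact (φ.eq_of_map_r_eq_self this).symm
    rw [hγ] at h
    refine ⟨γ i, ?_⟩
    simp [← huniq _ _ h]
  refine ⟨Equiv.ofBijective _ ⟨hinj, hsurj⟩, fun s => ?_⟩
  ext ⟨x', y'⟩
  obtain ⟨x, rfl⟩ := hsurj x'
  obtain ⟨y, rfl⟩ := hsurj y'
  have hxy : X'.r (g x i) (g y i) = φ.toEquiv s ↔ X.r x y = s := by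
    rw [← hpair, φ.toEquiv.apply_eq_iff_eq]
  constructor
  · rintro ⟨⟨u, v⟩, huv, he⟩
    obtain ⟨hu, hv⟩ := Prod.mk.inj he
    obtain rfl := hinj hu
    obtain rfl := hinj hv
    exact hxy.2 huv
  · intro h
    exact ⟨(x, y), hxy.1 h, rfl⟩

theorem separabilityNumber_le_of_isMSeparable (X : CoherentConfiguration Ω) {m : ℕ} (hm : 1 ≤ m)
    (h : X.IsMSeparable m) : X.separabilityNumber ≤ m :=
  iInf_le_of_le m (iInf_le_of_le hm (iInf_le _ h))

/-- Equality of the basis relations of the pairs `(x, y)` and `(z, w)` in the `3`-extension with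
the first two entries fixed to be `a` and `b`. -/
def TwoPointRel (X : CoherentConfiguration Ω) (a b x y z w : Ω) : Prop :=
  (X.mExtension 3).rel (![a, b, x], ![a, b, y]) (![a, b, z], ![a, b, w])

namespace TwoPointRel

variable {X : CoherentConfiguration Ω} {a b x y z w : Ω}

theorem swap (h : X.TwoPointRel a b x y z w) : X.TwoPointRel a b y x w z :=
  (X.mExtension 3).transpose h

theorem rel (h : X.TwoPointRel a b x y z w) : X.rel (x, y) (z, w) :=
  X.rel_apply_of_mExtension_rel h 2

/-- Fixing two points keeps the triangle property: the first two entries of the new tuple are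
forced, since their colours with `a` and `b` are diagonal. -/
theorem exists_third (h : X.TwoPointRel a b x y z w) (u : Ω) :
    ∃ v, X.TwoPointRel a b x u z v ∧ X.TwoPointRel a b u y v w := by
  obtain ⟨γ, h1, h2⟩ := (X.mExtension 3).exists_of_rel h ![a, b, u]
  have ha : a = γ 0 := X.diag (X.rel_apply_of_mExtension_rel h1 0)
  have hb : b = γ 1 := X.diag (X.rel_apply_of_mExtension_rel h1 1)
  have hγ : γ = ![a, b, γ 2] := by
    ext i
    fin_cases i
    · exact ha.symm
    · exact hb.symm
    · rfl
  rw [hγ] at h1 h2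
  exact ⟨γ 2, h1, h2⟩

theorem left (h : X.TwoPointRel a b x y z w) : X.TwoPointRel a b x x z z := by
  obtain ⟨v, h1, h2⟩ := h.exists_third x
  obtain rfl : z = v := X.diag h1.rel
  exact h1

theorem rel_fst (h : X.TwoPointRel a b x y z w) : X.rel (a, x) (a, z) :=
  X.rel_entries_of_mExtension_rel h.left 0 2

theorem rel_snd (h : X.TwoPointRel a b x y z w) : X.rel (b, x) (b, z) :=
  X.rel_entries_of_mExtension_rel h.left 1 2

end TwoPointRel

end Extension

end CoherentConfiguration

open CoherentConfiguration

/-! ### Recovering coordinates in the Passman scheme -/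

section Passman

variable {F : Type u} [Field F]

/-- The product of the coordinates of a difference is invariant up to sign. -/
theorem passmanScheme_rel_sq {x y z w : Fin 2 → F} (h : (passmanScheme F).rel (x, y) (z, w)) :
    ((x 0 - y 0) * (x 1 - y 1)) ^ 2 = ((z 0 - w 0) * (z 1 - w 1)) ^ 2 := by
  obtain ⟨⟨g, A, b, hA, hd, hg⟩, he⟩ := MulAction.orbitRel_apply.1 h
  obtain ⟨h1, h2⟩ := Prod.mk.inj he
  have h1' : A.mulVec z + b = x := (hg z).symm.trans h1
  have h2' : A.mulVec w + b = y := (hg w).symm.trans h2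
  have hd2 : A.det ^ 2 = 1 := by rcases hd with hd | hd <;> simp [hd]
  rw [Matrix.det_fin_two] at hd2
  rw [← h1', ← h2']
  rcases (Matrix.isMonomial_fin_two_iff A).1 hA with ⟨-, h01, h10, -⟩ | ⟨h00, -, -, h11⟩
  · simp only [Matrix.mulVec, dotProduct, Fin.sum_univ_two, Pi.add_apply, h01, h10] at hd2 ⊢
    linear_combination ((z 0 - w 0) * (z 1 - w 1)) ^ 2 * hd2
  · simp only [Matrix.mulVec, dotProduct, Fin.sum_univ_two, Pi.add_apply, h00, h11] at hd2 ⊢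
    linear_combination ((z 0 - w 0) * (z 1 - w 1)) ^ 2 * hd2

variable [Finite F]

theorem CoherentConfiguration.TwoPointRel.passman_sq {x y z w : Fin 2 → F}
    (h : (passmanScheme F).TwoPointRel ![0, 0] ![1, 0] x y z w) :
    (x 0 * x 1) ^ 2 = (z 0 * z 1) ^ 2 ∧
      ((x 0 - 1) * x 1) ^ 2 = ((z 0 - 1) * z 1) ^ 2 := by
  have h1 := passmanScheme_rel_sq h.rel_fst
  have h2 := passmanScheme_rel_sq h.rel_snd
  simp only [Matrix.cons_val_zero, Matrix.cons_val_one] at h1 h2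
  exact ⟨by linear_combination h1, by linear_combination h2⟩

theorem CoherentConfiguration.TwoPointRel.passman_snd_sq {x y z w : Fin 2 → F}
    (h : (passmanScheme F).TwoPointRel ![0, 0] ![1, 0] x y z w) : x 1 ^ 2 = z 1 ^ 2 := by
  obtain ⟨h1, h2⟩ := h.passman_sq
  by_cases hx : x 1 = 0
  · rw [hx] at h1 h2 ⊢
    by_contra hz
    -- Otherwise both vanishing products would force `z 0 = 0` and `z 0 = 1`.
    have hz' : z 1 ≠ 0 := fun e => hz (by rw [e])
    have e1 : z 0 = 0 := by simpa [hz'] using h1.symm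
    have e2 : z 0 - 1 = 0 := by simpa [hz'] using h2.symm
    rw [e1] at e2
    simp at e2
  -- The auxiliary point is the projection of `x` to the second axis. Its counterpart `v` lies on
  -- that axis with `v 1 ^ 2 = x 1 ^ 2`, and shares a coordinate with `z`.
  · obtain ⟨v, hv, -⟩ := h.exists_third ![0, x 1]
    obtain ⟨k1, k2⟩ := hv.swap.passman_sq
    have hQ := passmanScheme_rel_sq hv.rel
    simp only [Matrix.cons_val_zero, Matrix.cons_val_one] at k1 k2 hQ
    have hv1 : v 1 ≠ 0 := by
      intro e
      rw [e] at k2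
      simp [hx] at k2
    have hv0 : v 0 = 0 := by simpa [hv1] using k1.symm
    have hzv : z 0 = 0 ∨ z 1 = v 1 := by
      have : (z 0 - v 0) * (z 1 - v 1) = 0 := by simpa using hQ.symm
      rw [hv0, sub_zero] at this
      exact (mul_eq_zero.1 this).imp_right sub_eq_zero.1
    rcases hzv with hz | hz
    · have hx0 : x 0 = 0 := by simpa [hz, hx] using h1
      rw [hz, hx0] at h2
      linear_combination h2
    · rw [hz]
      rw [hv0] at k2
      linear_combination k2

theorem CoherentConfiguration.TwoPointRel.passman_fst_eq (h2 : (2 : F) ≠ 0) {x y z w : Fin 2 → F}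
    (h : (passmanScheme F).TwoPointRel ![0, 0] ![1, 0] x y z w) : x 0 = z 0 := by
  have off_axis : ∀ {x y z w : Fin 2 → F},
      (passmanScheme F).TwoPointRel ![0, 0] ![1, 0] x y z w → x 1 ≠ 0 → x 0 = z 0 := by
    intro x y z w h hx
    obtain ⟨k1, k2⟩ := h.passman_sq
    have k3 := h.passman_snd_sq
    -- The difference of the two invariants is `(2 * x 0 - 1) * x 1 ^ 2`, which is linear in `x 0`.
    have : 2 * x 1 ^ 2 * (x 0 - z 0) = 0 := by
      linear_combination k1 - k2 + (1 - 2 * z 0) * k3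
    simpa [h2, hx, sub_eq_zero] using this
  by_cases hx : x 1 = 0
  · have hz : z 1 = 0 := by simpa [hx] using h.passman_snd_sq.symm
    -- Any point off the first axis with the same first coordinate as `x` would do; its first
    -- coordinate is already known to be preserved.
    obtain ⟨v, hv, -⟩ := h.exists_third ![x 0, 1]
    have hv0 := off_axis hv.swap (by simp)
    have hv1 := hv.swap.passman_snd_sq
    have hQ := passmanScheme_rel_sq hv.rel
    simp only [Matrix.cons_val_zero, Matrix.cons_val_one] at hv0 hv1 hQ
    have hv1' : v 1 ≠ 0 := by
      intro e
      rw [e] at hv1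
      simp at hv1
    rw [hz, ← hv0] at hQ
    have : z 0 - x 0 = 0 := by simpa [hv1'] using hQ.symm
    exact (sub_eq_zero.1 this).symm
  · exact off_axis h hx

/-- Every point is determined by its basis relation with `(0, 1)` after `(0, 0)` and `(1, 0)` are
fixed. -/
theorem CoherentConfiguration.TwoPointRel.passman_eq (h2 : (2 : F) ≠ 0) {x y : Fin 2 → F}
    (h : (passmanScheme F).TwoPointRel ![0, 0] ![1, 0] ![0, 1] x ![0, 1] y) : x = y := by
  have off_axis : ∀ {x y : Fin 2 → F},
      (passmanScheme F).TwoPointRel ![0, 0] ![1, 0] ![0, 1] x ![0, 1] y → x 0 ≠ 0 → x = y := by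
    intro x y h hx
    have h0 := h.swap.passman_fst_eq h2
    have h1 := h.swap.passman_snd_sq
    have hQ := passmanScheme_rel_sq h.rel
    simp only [Matrix.cons_val_zero, Matrix.cons_val_one] at hQ
    rw [← h0] at hQ
    -- In the expansion of `(x 0 * (1 - x 1)) ^ 2` only the linear term in `x 1` is not yet known to
    -- agree.
    have : 2 * x 0 ^ 2 * (x 1 - y 1) = 0 := by
      linear_combination x 0 ^ 2 * h1 - hQ
    have h1' : x 1 = y 1 := by simpa [h2, hx, sub_eq_zero] using this
    ext i
    fin_cases i
    · exact h0
    · exact h1'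
  by_cases hx : x 0 = 0
  · have h0 := h.swap.passman_fst_eq h2
    -- The point `(1, x 1)` is already determined, and it lies on the horizontal line through `x`.
    obtain ⟨v, hv, hv'⟩ := h.exists_third ![1, x 1]
    obtain rfl := off_axis hv (by simp)
    have hQ := passmanScheme_rel_sq hv'.rel
    simp only [Matrix.cons_val_zero, Matrix.cons_val_one] at hQ
    rw [← h0, hx] at hQ
    have h1 : x 1 - y 1 = 0 := by simpa using hQ.symm
    ext i
    fin_cases i
    · exact h0
    · exact sub_eq_zero.1 h1
  · exact off_axis h hx

theorem passmanScheme_isMSeparable_three (h2 : (2 : F) ≠ 0) :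
    (passmanScheme F).IsMSeparable 3 := by
  refine (passmanScheme F).isMSeparable_of_update ![![0, 0], ![1, 0], ![0, 1]] 2 fun x y h => ?_
  have hupd : ∀ x : Fin 2 → F,
      Function.update ![![0, 0], ![1, 0], ![0, 1]] 2 x = ![![0, 0], ![1, 0], x] := by
    intro x
    ext i : 1
    fin_cases i <;> simp
  rw [hupd, hupd] at h
  exact TwoPointRel.passman_eq h2 h

end Passman

theorem theorem1p4 (F : Type u) [Field F] [Finite F] (hF : Odd (Nat.card F)) :
    (passmanScheme F).separabilityNumber ≤ 3 := by
  refine separabilityNumber_le_of_isMSeparable _ (by norm_num)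
    (passmanScheme_isMSeparable_three fun h2 => ?_)
  -- If `2 = 0`, the additive order of `1` divides `2`; it is not `1`, so it is `2` and divides the
  -- odd order of `F`.
  have hdvd : addOrderOf (1 : F) ∣ 2 := addOrderOf_dvd_of_nsmul_eq_zero (by simpa using h2)
  rcases (Nat.dvd_prime Nat.prime_two).1 hdvd with h | h
  · exact one_ne_zero (AddMonoid.addOrderOf_eq_one_iff.1 h)
  · have := addOrderOf_dvd_natCard (1 : F)
    rw [h] at this
    exact (Nat.not_even_iff_odd.2 hF) (even_iff_two_dvd.2 this)
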